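/- Theorem 3.2. For integers $k\ge 1$ put $$\tilde c(4k)=\frac{1}{\pi^{3/4}\,\Gamma(5/4+2k)\,(2k-1/4)\,\zeta(1/2+4k)},\qquad P_0(z)=-\sum_{k\ge 1}\tilde c(4k)\,(-z^2)^k\quad(z\in\mathbb C),$$ where $\zeta$ is the Riemann zeta function. The series converges absolutely for every $z\in\mathbb C$, and $P_0$ is an entire function. (i) $P_0(z)=O(z^2)$ as $z\to 0$ in $\mathbb C$. (ii) For every $\varepsilon>0$, $|P_0(v)|=O(v^{1/4+\varepsilon})$ as $v\to+\infty$ along the real axis (the implied constant may depend on $\varepsilon$). Moreover, the nonzero Taylor coefficients of $P_0$ at $0$ alternate in sign: the coefficients of $z^n$ with $n=0$ or $n$ odd vanish, and for every $k\ge 1$ the coefficient of $z^{2k}$ is real, nonzero and has sign $(-1)^{k+1}$. -/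

import Mathlib

open Filter Topology Asymptotics

namespace ZetaLaplace

/-- The coefficient `c̃(4k) = 1 / (π^{3/4} Γ(5/4 + 2k) (2k - 1/4) ζ(1/2 + 4k))`, as a function of
the integer `k ≥ 0`. -/
noncomputable def cTilde (k : ℕ) : ℂ :=
  1 / (((Real.pi ^ (3 / 4 : ℝ) * Real.Gamma (5 / 4 + 2 * (k : ℝ)) * (2 * (k : ℝ) - 1 / 4) : ℝ) : ℂ)
    * riemannZeta (1 / 2 + 4 * (k : ℂ)))

/-- The `k`-th term `c̃(4k) (-z²)^k`. -/
noncomputable def term (k : ℕ) (z : ℂ) : ℂ := cTilde k * (-z ^ 2) ^ k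

/-- `P₀(z) = - ∑_{k ≥ 1} c̃(4k) (-z²)^k`; the index `k ≥ 1` is written `k + 1` with `k : ℕ`. -/
noncomputable def P0 (z : ℂ) : ℂ := - ∑' k : ℕ, term (k + 1) z

/-- The `n`-th Taylor coefficient at `0`. -/
noncomputable def taylorCoeffZero (f : ℂ → ℂ) (n : ℕ) : ℂ :=
  iteratedDeriv n f 0 / (n.factorial : ℂ)

end ZetaLaplace

open MeasureTheory

/-! On the real line `P0` is, up to sign and a constant, an iterated average of `cos y - 1`. Each
map `φ ↦ ∫ w t * φ (x * g t)` multiplies the coefficient of `x ^ m` by the moment `∫ g ^ m * w`. The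
weight `(1 - t) ^ (-3/4)` trades `1 / m!` for `1 / Γ(m + 5/4)`, `t ^ (-5/4)` contributes `1 / (m -
1/4)`, and summing `μ(n) n ^ (-1/2)` with `g = 1 / n²` contributes `1 / ζ(1/2 + 2m)`; put `m = 2k`.
Each average also preserves a bound `O(x ^ p)` when `g ^ p * |w|` is integrable. The last two
weights require `p > 1/4`, which is the source of the exponent in (ii). The signs follow from
positivity of `Γ` and `ζ` at the arguments involved. -/

theorem abs_cos_sub_one_le_rpow {p y : ℝ} (hp0 : 0 ≤ p) (hp2 : p ≤ 2) (hy : 0 ≤ y) :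
    |Real.cos y - 1| ≤ 2 * y ^ p := by
  rw [abs_sub_comm, abs_of_nonneg (sub_nonneg.2 (Real.cos_le_one y))]
  -- Quadratic decay wins below 1, the trivial bound 2 above.
  rcases le_total y 1 with h | h
  · have h1 := Real.one_sub_sq_div_two_le_cos (x := y)
    have h2 : y ^ (2 : ℝ) ≤ y ^ p := by
      rcases hy.eq_or_lt with rfl | hy'
      · rw [Real.zero_rpow two_ne_zero]
        exact Real.rpow_nonneg le_rfl p
      · exact Real.rpow_le_rpow_of_exponent_ge hy' h hp2
    rw [Real.rpow_two] at h2
    nlinarith [sq_nonneg y]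
  · have h1 := Real.neg_one_le_cos y
    have h2 : 1 ≤ y ^ p := Real.one_le_rpow h hp0
    linarith

theorem hasSum_cos_sub_one (y : ℝ) :
    HasSum (fun k : ℕ => (-1) ^ (k + 1) / ((2 * (k + 1)).factorial : ℝ) * y ^ (2 * (k + 1)))
      (Real.cos y - 1) := by
  have h := (hasSum_nat_add_iff' 1).2 (Real.hasSum_cos y)
  simpa [div_mul_eq_mul_div] using h

/-! ### Averages of even power series -/

section
variable {α : Type*} [MeasurableSpace α] {ν : Measure α} {g w : α → ℝ}

theorem integrable_pow_mul (hg : ∀ᵐ t ∂ν, 0 ≤ g t ∧ g t ≤ 1) (hgm : AEStronglyMeasurable g ν)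
    (hw : Integrable (fun t => g t ^ 2 * w t) ν) (k : ℕ) :
    Integrable (fun t => g t ^ (2 * (k + 1)) * w t) ν := by
  have h := hw.bdd_mul (c := 1) (hgm.pow (2 * k)) (by
    filter_upwards [hg] with t ht
    simp only [Pi.pow_apply, norm_pow, Real.norm_of_nonneg ht.1]
    exact pow_le_one₀ ht.1 ht.2)
  refine h.congr (ae_of_all _ fun t => ?_)
  simp only [Pi.pow_apply]
  ring

/-- Since `g ^ (2 * (k + 1)) ≤ g ^ 2`, the terms are dominated by the series of `φ` at `x`. Only `g
^ 2 * w` need be integrable: `t ^ (-5/4)` itself is not. -/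
theorem hasSum_integral_even_powerSeries (hg : ∀ᵐ t ∂ν, 0 ≤ g t ∧ g t ≤ 1)
    (hgm : AEStronglyMeasurable g ν) (hw : Integrable (fun t => g t ^ 2 * w t) ν)
    {a : ℕ → ℝ} {φ : ℝ → ℝ} (hφ : ∀ y, HasSum (fun k => a k * y ^ (2 * (k + 1))) (φ y)) (x : ℝ) :
    HasSum (fun k => a k * (∫ t, g t ^ (2 * (k + 1)) * w t ∂ν) * x ^ (2 * (k + 1)))
      (∫ t, w t * φ (x * g t) ∂ν) := by
  have key := hasSum_integral_of_summable_integral_norm (μ := ν)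
    (F := fun k t => a k * x ^ (2 * (k + 1)) * (g t ^ (2 * (k + 1)) * w t))
    (fun k => (integrable_pow_mul hg hgm hw k).const_mul _) ?_
  · have h1 : ∀ k, ∫ t, a k * x ^ (2 * (k + 1)) * (g t ^ (2 * (k + 1)) * w t) ∂ν
        = a k * (∫ t, g t ^ (2 * (k + 1)) * w t ∂ν) * x ^ (2 * (k + 1)) := fun k => by
      rw [integral_const_mul]
      ring
    have h2 : ∀ t, ∑' k, a k * x ^ (2 * (k + 1)) * (g t ^ (2 * (k + 1)) * w t)
        = w t * φ (x * g t) := fun t => by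
      rw [← ((hφ (x * g t)).mul_left (w t)).tsum_eq]
      refine tsum_congr fun k => ?_
      ring
    simpa only [h1, h2] using key
  · refine Summable.of_nonneg_of_le (fun k => integral_nonneg fun t => norm_nonneg _)
      (fun k => ?_) ((hφ x).summable.norm.mul_right (∫ t, ‖g t ^ 2 * w t‖ ∂ν))
    rw [← integral_const_mul]
    refine integral_mono_ae ((integrable_pow_mul hg hgm hw k).const_mul _).norm
      (hw.norm.const_mul _) ?_
    filter_upwards [hg] with t ht
    simp only [norm_mul, norm_pow, Real.norm_of_nonneg ht.1]
    gcongr ?_ * (?_ * _)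
    exact pow_le_pow_of_le_one ht.1 ht.2 (by omega)

theorem exists_abs_integral_mul_comp_le_rpow (hg : ∀ᵐ t ∂ν, 0 ≤ g t) {p : ℝ} {φ : ℝ → ℝ}
    (hφ : ∃ C, ∀ y, 0 ≤ y → |φ y| ≤ C * y ^ p) (hw : Integrable (fun t => g t ^ p * |w t|) ν) :
    ∃ C, ∀ x, 0 ≤ x → |∫ t, w t * φ (x * g t) ∂ν| ≤ C * x ^ p := by
  obtain ⟨C, hC⟩ := hφ
  refine ⟨C * ∫ t, g t ^ p * |w t| ∂ν, fun x hx => ?_⟩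
  have h := norm_integral_le_of_norm_le (f := fun t => w t * φ (x * g t))
    (hw.const_mul (C * x ^ p)) (by
      filter_upwards [hg] with t ht
      have := mul_le_mul_of_nonneg_left (hC (x * g t) (mul_nonneg hx ht)) (abs_nonneg (w t))
      rw [Real.mul_rpow hx ht] at this
      rw [norm_mul, Real.norm_eq_abs, Real.norm_eq_abs]
      linarith)
  rw [integral_const_mul, Real.norm_eq_abs] at h
  linarith
end

/-! ### Moments of the three weights -/

theorem integral_pow_mul_one_sub_rpow (n : ℕ) {b : ℝ} (hb : 0 < b) :
    ∫ t in Set.Ioc (0 : ℝ) 1, t ^ n * (1 - t) ^ (b - 1)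
      = n.factorial * Real.Gamma b / Real.Gamma (n + 1 + b) := by
  have h := Complex.betaIntegral_eq_Gamma_mul_div (n + 1 : ℂ) (b : ℂ)
    (by simp; positivity) (by simpa)
  rw [Complex.betaIntegral, Complex.Gamma_nat_eq_factorial,
    intervalIntegral.integral_of_le zero_le_one] at h
  have h2 : ((∫ t in Set.Ioc (0 : ℝ) 1, t ^ n * (1 - t) ^ (b - 1) : ℝ) : ℂ)
      = ((n.factorial * Real.Gamma b / Real.Gamma (n + 1 + b) : ℝ) : ℂ) := by
    push_cast [← Complex.Gamma_ofReal]
    rw [← h, ← integral_complex_ofReal]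
    refine setIntegral_congr_fun measurableSet_Ioc fun t ht => ?_
    push_cast [Complex.ofReal_cpow (sub_nonneg.2 ht.2)]
    simp
  exact_mod_cast h2

theorem integrableOn_one_sub_rpow {r : ℝ} (hr : -1 < r) :
    IntegrableOn (fun t : ℝ => (1 - t) ^ r) (Set.Ioc 0 1) := by
  have h := (intervalIntegral.intervalIntegrable_rpow' (a := 0) (b := 1) hr).comp_sub_left 1
  simp only [sub_zero, sub_self] at h
  exact (intervalIntegrable_iff_integrableOn_Ioc_of_le zero_le_one).1 h.symm

theorem integrableOn_rpow {r : ℝ} (hr : -1 < r) :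
    IntegrableOn (fun t : ℝ => t ^ r) (Set.Ioc 0 1) :=
  (intervalIntegrable_iff_integrableOn_Ioc_of_le zero_le_one).1
    (intervalIntegral.intervalIntegrable_rpow' hr)

theorem integral_Ioc_rpow {r : ℝ} (hr : -1 < r) :
    ∫ t in Set.Ioc (0 : ℝ) 1, t ^ r = 1 / (r + 1) := by
  rw [← intervalIntegral.integral_of_le zero_le_one, integral_rpow (Or.inl hr)]
  simp [Real.zero_rpow (by linarith : r + 1 ≠ 0)]

open ArithmeticFunction in
theorem tsum_moebius_mul_rpow {s : ℝ} (hs : 1 < s) :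
    ((∑' n : ℕ, (moebius n : ℝ) * (n : ℝ) ^ (-s) : ℝ) : ℂ) = 1 / riemannZeta s := by
  have h := LSeries_zeta_mul_Lseries_moebius (s := s) (by simpa)
  rw [LSeries_zeta_eq_riemannZeta (by simpa)] at h
  rw [eq_div_iff (left_ne_zero_of_mul_eq_one h), mul_comm, ← h, LSeries, Complex.ofReal_tsum]
  congr 2
  ext n
  rcases eq_or_ne n 0 with rfl | hn
  · simp
  · rw [LSeries.term_of_ne_zero hn, Real.rpow_neg (by positivity)]
    push_cast [Complex.ofReal_cpow (Nat.cast_nonneg n)]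
    rfl

open ArithmeticFunction in
theorem tsum_moebius_mul_rpow_eq_one_div_re {s : ℝ} (hs : 1 < s) :
    ∑' n : ℕ, (moebius n : ℝ) * (n : ℝ) ^ (-s) = 1 / (riemannZeta s).re := by
  have h := tsum_moebius_mul_rpow hs
  have h2 : riemannZeta s = ((riemannZeta s).re : ℂ) :=
    Complex.ext (by simp) (by simpa using riemannZeta_im_eq_zero_of_one_lt hs)
  rw [h2] at h
  exact_mod_cast h

open ArithmeticFunction in
theorem integrable_inv_sq_rpow_mul_moebius {p : ℝ} (hp : 1 / 4 < p) :
    Integrable (fun n : ℕ => (1 / (n : ℝ) ^ 2) ^ p * |(moebius n : ℝ) * (n : ℝ) ^ (-(1 / 2) : ℝ)|)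
      Measure.count := by
  rw [integrable_count_iff]
  refine Summable.of_nonneg_of_le (fun n => norm_nonneg _) (fun n => ?_)
    (Real.summable_nat_rpow.2 (by linarith : -(2 * p) + -(1 / 2) < -1))
  -- The junk value at `n = 0` is killed by `μ(0) = 0`.
  rcases eq_or_ne n 0 with rfl | hn
  · simp only [ArithmeticFunction.map_zero, Int.cast_zero, zero_mul, abs_zero, mul_zero, norm_zero]
    positivity
  · have hn' : (0 : ℝ) < n := by positivity
    have hm : |(moebius n : ℝ)| ≤ 1 := by exact_mod_cast abs_moebius_le_one
    have h1 : (1 / (n : ℝ) ^ 2) ^ p = (n : ℝ) ^ (-(2 * p)) := by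
      rw [one_div, Real.inv_rpow (by positivity), ← Real.rpow_natCast, ← Real.rpow_mul hn'.le,
        ← Real.rpow_neg hn'.le]
      norm_num
    rw [Real.rpow_add hn', h1, abs_mul, abs_of_nonneg (Real.rpow_nonneg hn'.le (-(1 / 2))),
      Real.norm_of_nonneg (by positivity)]
    gcongr
    exact mul_le_of_le_one_left (by positivity) hm

open ArithmeticFunction in
theorem integral_inv_sq_pow_mul_moebius (k : ℕ) :
    ∫ n : ℕ, (1 / (n : ℝ) ^ 2) ^ (2 * (k + 1)) * ((moebius n : ℝ) * (n : ℝ) ^ (-(1 / 2) : ℝ))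
      ∂Measure.count = 1 / (riemannZeta ((1 / 2 + 4 * ((k : ℝ) + 1) : ℝ) : ℂ)).re := by
  rw [← tsum_moebius_mul_rpow_eq_one_div_re (by linarith [Nat.cast_nonneg (α := ℝ) k])]
  have hp : (1 : ℝ) / 4 < ((2 * (k + 1) : ℕ) : ℝ) := by
    push_cast
    linarith [Nat.cast_nonneg (α := ℝ) k]
  have hi := integrable_inv_sq_rpow_mul_moebius hp
  rw [integral_countable]
  · refine tsum_congr fun n => ?_
    rcases eq_or_ne n 0 with rfl | hn
    · simp
    · have hn' : (0 : ℝ) < n := by positivity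
      have h1 : (1 / (n : ℝ) ^ 2) ^ (2 * (k + 1)) = (n : ℝ) ^ (-(4 * ((k : ℝ) + 1))) := by
        rw [one_div, inv_pow, ← pow_mul, Real.rpow_neg hn'.le, ← Real.rpow_natCast]
        push_cast
        ring_nf
      rw [h1, count_real_singleton, one_smul, neg_add (1 / 2 : ℝ), Real.rpow_add hn']
      ring
  · rw [integrable_count_iff] at hi ⊢
    simp only [Real.rpow_natCast] at hi
    simpa using hi

/-! ### The real series and its growth -/

/-- The coefficient `c̃(4(k+1))` as a real number. -/
noncomputable def cTildeSuccReal (k : ℕ) : ℝ :=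
  1 / (Real.pi ^ (3 / 4 : ℝ) * Real.Gamma (5 / 4 + 2 * ((k : ℝ) + 1)) * (2 * ((k : ℝ) + 1) - 1 / 4)
    * (riemannZeta ((1 / 2 + 4 * ((k : ℝ) + 1) : ℝ) : ℂ)).re)

theorem cTildeSuccReal_pos (k : ℕ) : 0 < cTildeSuccReal k := by
  have hk := Nat.cast_nonneg (α := ℝ) k
  have h1 := riemannZeta_re_pos_of_one_lt (x := 1 / 2 + 4 * ((k : ℝ) + 1)) (by linarith)
  have h2 := Real.Gamma_pos_of_pos (s := 5 / 4 + 2 * ((k : ℝ) + 1)) (by linarith)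
  have h3 : 0 < 2 * ((k : ℝ) + 1) - 1 / 4 := by linarith
  unfold cTildeSuccReal
  positivity

open ArithmeticFunction in
theorem exists_hasSum_cTildeSuccReal :
    ∃ Φ : ℝ → ℝ,
      (∀ x, HasSum (fun k => (-1) ^ (k + 1) * cTildeSuccReal k * x ^ (2 * (k + 1))) (Φ x)) ∧
      ∀ ε : ℝ, 0 < ε → ε ≤ 1 → ∃ C, ∀ x, 0 ≤ x → |Φ x| ≤ C * x ^ (1 / 4 + ε) := by
  have hunit : ∀ᵐ t : ℝ ∂volume.restrict (Set.Ioc 0 1), 0 ≤ t ∧ t ≤ 1 :=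
    ae_restrict_of_forall_mem measurableSet_Ioc fun t ht => ⟨ht.1.le, ht.2⟩
  have hnat : ∀ᵐ n : ℕ ∂Measure.count, 0 ≤ 1 / (n : ℝ) ^ 2 ∧ 1 / (n : ℝ) ^ 2 ≤ 1 := by
    refine ae_of_all _ fun n => ⟨by positivity, ?_⟩
    rcases eq_or_ne n 0 with rfl | hn
    · simp
    · exact (div_le_one (by positivity)).2
        (one_le_pow₀ (by exact_mod_cast Nat.one_le_iff_ne_zero.2 hn))
  have hid : AEStronglyMeasurable (fun t : ℝ => t) (volume.restrict (Set.Ioc 0 1)) :=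
    measurable_id.aestronglyMeasurable
  -- integrability of the three weights against powers
  have hw1 : ∀ p : ℝ, 0 ≤ p → Integrable (fun t : ℝ => t ^ p * |(1 - t) ^ (1 / 4 - 1 : ℝ)|)
      (volume.restrict (Set.Ioc 0 1)) := fun p hp => by
    refine (integrableOn_one_sub_rpow (r := 1 / 4 - 1) (by norm_num)).norm.bdd_mul (c := 1)
      (Measurable.aestronglyMeasurable (by fun_prop)) ?_
    filter_upwards [hunit] with t ht
    rw [Real.norm_of_nonneg (Real.rpow_nonneg ht.1 p)]
    exact Real.rpow_le_one ht.1 ht.2 hp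
  have hmul2 : ∀ p : ℝ, ∀ᵐ t : ℝ ∂volume.restrict (Set.Ioc 0 1),
      t ^ (p - 5 / 4) = t ^ p * |t ^ (-(5 / 4) : ℝ)| := fun p =>
    ae_restrict_of_forall_mem measurableSet_Ioc fun t ht => by
      rw [abs_of_nonneg (Real.rpow_nonneg ht.1.le _), ← Real.rpow_add ht.1, sub_eq_add_neg]
  have hw2 : ∀ p : ℝ, 1 / 4 < p → Integrable (fun t : ℝ => t ^ p * |t ^ (-(5 / 4) : ℝ)|)
      (volume.restrict (Set.Ioc 0 1)) := fun p hp =>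
    (integrableOn_rpow (r := p - 5 / 4) (by linarith)).congr (hmul2 p)
  have hw1' : Integrable (fun t : ℝ => t ^ 2 * (1 - t) ^ (1 / 4 - 1 : ℝ))
      (volume.restrict (Set.Ioc 0 1)) := by
    refine (hw1 2 two_pos.le).congr ?_
    filter_upwards [hunit] with t ht
    rw [abs_of_nonneg (Real.rpow_nonneg (by linarith [ht.2]) _), Real.rpow_two]
  have hw2' : Integrable (fun t : ℝ => t ^ 2 * t ^ (-(5 / 4) : ℝ))
      (volume.restrict (Set.Ioc 0 1)) := by
    refine (hw2 2 (by norm_num)).congr ?_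
    filter_upwards [hunit] with t ht
    rw [abs_of_nonneg (Real.rpow_nonneg ht.1 _), Real.rpow_two]
  have hw3' : Integrable (fun n : ℕ => (1 / (n : ℝ) ^ 2) ^ 2 *
      ((moebius n : ℝ) * (n : ℝ) ^ (-(1 / 2) : ℝ))) Measure.count := by
    have h := integrable_inv_sq_rpow_mul_moebius (p := 2) (by norm_num)
    rw [integrable_count_iff] at h ⊢
    simpa [Real.rpow_two] using h
  have s1 := hasSum_integral_even_powerSeries hunit hid hw1' hasSum_cos_sub_one
  have s2 := hasSum_integral_even_powerSeries hunit hid hw2' s1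
  have s3 := hasSum_integral_even_powerSeries hnat
    (measurable_from_top.aestronglyMeasurable) hw3' s2
  -- The prefactor cancels the `Γ(1/4)` of the beta integral and supplies `π ^ (-3/4)`.
  refine ⟨fun x => 1 / (Real.pi ^ (3 / 4 : ℝ) * Real.Gamma (1 / 4)) * _,
    fun x => ((s3 x).mul_left _).congr_fun fun k => ?_, fun ε hε hε1 => ?_⟩
  · have hk := Nat.cast_nonneg (α := ℝ) k
    have m2 : ∫ t in Set.Ioc (0 : ℝ) 1, t ^ (2 * (k + 1)) * t ^ (-(5 / 4) : ℝ)
        = 1 / (2 * ((k : ℝ) + 1) - 1 / 4) := by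
      rw [show 2 * ((k : ℝ) + 1) - 1 / 4 = (2 * ((k : ℝ) + 1) - 5 / 4) + 1 by ring,
        ← integral_Ioc_rpow (by linarith)]
      refine setIntegral_congr_fun measurableSet_Ioc fun t ht => ?_
      rw [← Real.rpow_natCast, ← Real.rpow_add ht.1]
      push_cast
      rfl
    rw [integral_pow_mul_one_sub_rpow _ (by norm_num), m2, integral_inv_sq_pow_mul_moebius,
      cTildeSuccReal]
    have e : ((2 * (k + 1) : ℕ) : ℝ) + 1 + 1 / 4 = 5 / 4 + 2 * ((k : ℝ) + 1) := by
      push_cast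
      ring
    have h0 : ((2 * (k + 1)).factorial : ℝ) ≠ 0 := by positivity
    have h1 : Real.Gamma (1 / 4) ≠ 0 := (Real.Gamma_pos_of_pos (by norm_num)).ne'
    rw [e]
    generalize Real.Gamma (5 / 4 + 2 * ((k : ℝ) + 1)) = G
    generalize (riemannZeta _).re = Z
    generalize 2 * ((k : ℝ) + 1) - 1 / 4 = q
    generalize ((2 * (k + 1)).factorial : ℝ) = F at *
    simp only [div_eq_mul_inv, mul_inv, one_mul]
    field_simp
  · obtain ⟨C, hC⟩ := exists_abs_integral_mul_comp_le_rpow (hnat.mono fun _ h => h.1)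
      (exists_abs_integral_mul_comp_le_rpow (hunit.mono fun _ h => h.1)
        (exists_abs_integral_mul_comp_le_rpow (hunit.mono fun _ h => h.1)
          ⟨2, fun y hy => abs_cos_sub_one_le_rpow (by linarith) (by linarith) hy⟩
          (hw1 (1 / 4 + ε) (by linarith)))
        (hw2 (1 / 4 + ε) (by linarith)))
      (integrable_inv_sq_rpow_mul_moebius (p := 1 / 4 + ε) (by linarith))
    refine ⟨|1 / (Real.pi ^ (3 / 4 : ℝ) * Real.Gamma (1 / 4))| * C, fun x hx => ?_⟩
    rw [abs_mul, mul_assoc]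
    exact mul_le_mul_of_nonneg_left (hC x hx) (abs_nonneg _)

/-! ### Transfer to the complex function -/

theorem ZetaLaplace.cTilde_succ (k : ℕ) :
    ZetaLaplace.cTilde (k + 1) = (cTildeSuccReal k : ℂ) := by
  have h : riemannZeta (1 / 2 + 4 * ((k + 1 : ℕ) : ℂ))
      = ((riemannZeta ((1 / 2 + 4 * ((k : ℝ) + 1) : ℝ) : ℂ)).re : ℂ) := by
    have h1 : (1 / 2 + 4 * ((k + 1 : ℕ) : ℂ)) = ((1 / 2 + 4 * ((k : ℝ) + 1) : ℝ) : ℂ) := by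
      push_cast
      rfl
    rw [h1]
    refine Complex.ext (by simp) ?_
    rw [Complex.ofReal_im]
    exact riemannZeta_im_eq_zero_of_one_lt (by linarith [Nat.cast_nonneg (α := ℝ) k])
  rw [ZetaLaplace.cTilde, h, cTildeSuccReal]
  push_cast
  rfl

/-- An everywhere convergent power series sums to an entire function, and its coefficients are
the Taylor coefficients at `0`. -/
theorem differentiable_and_taylorCoeff_of_hasSum {f : ℂ → ℂ} {a : ℕ → ℂ}
    (h : ∀ z, HasSum (fun n => a n * z ^ n) (f z)) :
    Differentiable ℂ f ∧ ∀ n, iteratedDeriv n f 0 / (n.factorial : ℂ) = a n := by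
  have hball : HasFPowerSeriesOnBall f (FormalMultilinearSeries.ofScalars ℂ a) 0 ⊤ :=
    { r_le := by
        rw [top_le_iff]
        refine FormalMultilinearSeries.radius_eq_top_of_summable_norm _ fun r => ?_
        simpa using (h (r : ℝ)).summable.norm
      r_pos := ENNReal.zero_lt_top
      hasSum := fun {y} _ => by
        simpa [FormalMultilinearSeries.ofScalars_apply_eq, mul_comm] using h y }
  have hd : Differentiable ℂ f := fun z =>
    (hball.differentiableOn z (by simp)).differentiableAt (by simp)
  refine ⟨hd, fun n => ?_⟩
  have h2 := (hd.analyticAt 0).hasFPowerSeriesAt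
  have h3 := congrArg (fun p => FormalMultilinearSeries.coeff p n)
    (hball.hasFPowerSeriesAt.eq_formalMultilinearSeries h2)
  simpa [FormalMultilinearSeries.coeff_ofScalars] using h3.symm

theorem ZetaLaplace.summable_term (z : ℂ) :
    Summable fun k : ℕ => ZetaLaplace.term (k + 1) z := by
  obtain ⟨Φ, hΦ, -⟩ := exists_hasSum_cTildeSuccReal
  -- Term norms depend only on `‖z‖`, so the real series suffices.
  refine Summable.of_norm ((hΦ ‖z‖).summable.norm.congr fun k => ?_)
  simp [ZetaLaplace.term, ZetaLaplace.cTilde_succ, pow_mul]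

theorem ZetaLaplace.hasSum_P0 (z : ℂ) :
    HasSum (fun k : ℕ => (((-1 : ℝ) ^ (k + 2) * cTildeSuccReal k : ℝ) : ℂ) * z ^ (2 * (k + 1)))
      (ZetaLaplace.P0 z) := by
  refine (ZetaLaplace.summable_term z).hasSum.neg.congr_fun fun k => ?_
  simp only [ZetaLaplace.term, ZetaLaplace.cTilde_succ, neg_pow (z ^ 2), pow_mul]
  push_cast
  ring

/-- The power series coefficients of `P₀`. -/
noncomputable def ZetaLaplace.P0Coeff (n : ℕ) : ℂ :=
  if n ≠ 0 ∧ Even n then (((-1 : ℝ) ^ (n / 2 + 1) * cTildeSuccReal (n / 2 - 1) : ℝ) : ℂ) else 0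

theorem ZetaLaplace.P0Coeff_two_mul_succ (k : ℕ) :
    ZetaLaplace.P0Coeff (2 * (k + 1)) = (((-1 : ℝ) ^ (k + 2) * cTildeSuccReal k : ℝ) : ℂ) := by
  rw [ZetaLaplace.P0Coeff, if_pos ⟨by omega, even_two_mul _⟩, Nat.mul_div_cancel_left _ two_pos,
    Nat.add_sub_cancel]

theorem ZetaLaplace.hasSum_P0Coeff (z : ℂ) :
    HasSum (fun n => ZetaLaplace.P0Coeff n * z ^ n) (ZetaLaplace.P0 z) := by
  have hinj : Function.Injective fun k : ℕ => 2 * (k + 1) := fun a b h => by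
    simp only at h
    omega
  refine (hinj.hasSum_iff fun n hn => ?_).1
    ((ZetaLaplace.hasSum_P0 z).congr_fun fun k => ?_)
  · rw [ZetaLaplace.P0Coeff, if_neg, zero_mul]
    rintro ⟨h0, m, rfl⟩
    exact hn ⟨m - 1, by simp only; omega⟩
  · simp only [Function.comp_apply, ZetaLaplace.P0Coeff_two_mul_succ]

/-- In the unit disc each term is at most `‖z‖ ^ 2` times its norm at 1. -/
theorem ZetaLaplace.P0_isBigO_sq : ZetaLaplace.P0 =O[𝓝 (0 : ℂ)] fun z : ℂ => z ^ 2 := by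
  have hs := (ZetaLaplace.summable_term 1).norm
  refine IsBigO.of_bound (∑' k : ℕ, ‖ZetaLaplace.term (k + 1) 1‖) ?_
  filter_upwards [Metric.closedBall_mem_nhds (0 : ℂ) one_pos] with z hz
  rw [mem_closedBall_zero_iff] at hz
  rw [ZetaLaplace.P0, norm_neg]
  refine tsum_of_norm_bounded (hs.hasSum.mul_right _) fun k => ?_
  simp only [ZetaLaplace.term, norm_mul, norm_pow, norm_neg, norm_one, one_pow, mul_one]
  gcongr
  rw [pow_succ]
  exact mul_le_of_le_one_left (by positivity) (pow_le_one₀ (by positivity)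
    (pow_le_one₀ (norm_nonneg z) hz))

theorem ZetaLaplace.norm_P0_isBigO_rpow {ε : ℝ} (hε : 0 < ε) :
    (fun v : ℝ => ‖ZetaLaplace.P0 (v : ℂ)‖) =O[atTop] fun v : ℝ => v ^ (1 / 4 + ε) := by
  obtain ⟨Φ, hΦ, hb⟩ := exists_hasSum_cTildeSuccReal
  -- The cosine bound needs a bounded exponent, hence the cap; for `v ≥ 1` raising the exponent back
  -- to `1/4 + ε` only weakens the bound.
  obtain ⟨C, hC⟩ := hb (min ε 1) (lt_min hε one_pos) (min_le_right _ _)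
  refine IsBigO.of_bound |C| ?_
  filter_upwards [eventually_ge_atTop 1] with v hv
  have hv0 : 0 ≤ v := zero_le_one.trans hv
  have h1 : ZetaLaplace.P0 (v : ℂ) = ((-Φ v : ℝ) : ℂ) := by
    refine (ZetaLaplace.hasSum_P0 v).unique
      ((Complex.hasSum_ofReal.2 (hΦ v).neg).congr_fun fun k => ?_)
    push_cast
    ring
  rw [norm_norm, h1, Complex.norm_real, norm_neg, Real.norm_eq_abs,
    Real.norm_of_nonneg (Real.rpow_nonneg hv0 _)]
  calc |Φ v| ≤ C * v ^ (1 / 4 + min ε 1) := hC v hv0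
    _ ≤ |C| * v ^ (1 / 4 + ε) := by
      gcongr
      · exact le_abs_self C
      exact min_le_left _ _

theorem theorem3p2 :
    -- the series defining `P₀` converges absolutely everywhere, and `P₀` is entire
    (∀ z : ℂ, Summable fun k : ℕ => ZetaLaplace.term (k + 1) z) ∧
    Differentiable ℂ ZetaLaplace.P0 ∧
    -- (i)
    (ZetaLaplace.P0 =O[𝓝 (0 : ℂ)] fun z : ℂ => z ^ 2) ∧
    -- (ii)
    (∀ ε : ℝ, 0 < ε →
      (fun v : ℝ => ‖ZetaLaplace.P0 (v : ℂ)‖) =O[atTop] fun v : ℝ => v ^ (1 / 4 + ε)) ∧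
    -- only the coefficients of `z^{2k}`, `k ≥ 1`, are nonzero, and they alternate in sign
    (∀ n : ℕ, n = 0 ∨ Odd n → ZetaLaplace.taylorCoeffZero ZetaLaplace.P0 n = 0) ∧
    (∀ k : ℕ, 1 ≤ k → ∃ r : ℝ, 0 < r ∧
      ZetaLaplace.taylorCoeffZero ZetaLaplace.P0 (2 * k) = (((-1 : ℝ) ^ (k + 1) * r : ℝ) : ℂ)) := by
  obtain ⟨hd, hc⟩ := differentiable_and_taylorCoeff_of_hasSum ZetaLaplace.hasSum_P0Coeff
  refine ⟨ZetaLaplace.summable_term, hd, ZetaLaplace.P0_isBigO_sq,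
    fun ε hε => ZetaLaplace.norm_P0_isBigO_rpow hε, fun n hn => (hc n).trans ?_, fun k hk => ?_⟩
  · rw [ZetaLaplace.P0Coeff, if_neg]
    rintro ⟨h0, he⟩
    rcases hn with h | h
    · exact h0 h
    · exact Nat.not_even_iff_odd.2 h he
  · obtain ⟨m, rfl⟩ := Nat.exists_eq_add_of_le' hk
    exact ⟨cTildeSuccReal m, cTildeSuccReal_pos m,
      (hc _).trans (ZetaLaplace.P0Coeff_two_mul_succ m)⟩
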